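/- For a finite simple undirected graph $G$, let $\rho(G)$ denote its adjacency spectral radius, that is, the largest eigenvalue of its adjacency matrix. A chord of a cycle $C$ in $G$ is an edge of $G$ joining two non-consecutive vertices of $C$, and a cycle is chorded if it has at least one chord. Let $n \ge 6$ and let $K_{2,n-2}$ be the complete bipartite graph with parts of sizes $2$ and $n-2$. Then $\rho(K_{2,n-2}) = \sqrt{2n-4}$, and for every simple graph $G$ on $n$ vertices with $\rho(G) \ge \rho(K_{2,n-2})$, the graph $G$ contains a chorded cycle if and only if $G \not\cong K_{2,n-2}$. In other words, $G$ contains a chorded cycle unless $G \cong K_{2,n-2}$, and $K_{2,n-2}$ itself contains no chorded cycle. -/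

import Mathlib

namespace SimpleGraph

open Classical in
/-- The adjacency spectral radius of a finite graph: the largest eigenvalue of its adjacency
matrix. The set of eigenvalues is finite, and nonempty if the graph has a vertex. -/
noncomputable def adjSpectralRadius {V : Type*} [Fintype V] (G : SimpleGraph V) : ℝ :=
  sSup (spectrum ℝ (G.adjMatrix ℝ))

open Classical in
/-- The supremum in the definition is attained: it is the largest eigenvalue. -/
theorem isGreatest_adjSpectralRadius {V : Type*} [Fintype V] [Nonempty V] (G : SimpleGraph V) :
    IsGreatest (spectrum ℝ (G.adjMatrix ℝ)) G.adjSpectralRadius := by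
  have hA : (G.adjMatrix ℝ).IsHermitian := by
    ext i j
    simp [SimpleGraph.adjMatrix_apply, G.adj_comm]
  have h := hA.spectrum_real_eq_range_eigenvalues
  have hfin : (spectrum ℝ (G.adjMatrix ℝ)).Finite := by
    rw [h]; exact Set.finite_range _
  have hne : (spectrum ℝ (G.adjMatrix ℝ)).Nonempty := by
    rw [h]; exact Set.range_nonempty _
  exact ⟨hne.csSup_mem hfin, fun x hx => le_csSup hfin.bddAbove hx⟩

/-- `G` contains a chorded cycle: a cycle together with an edge of `G` that joins two vertices of
the cycle and is not an edge of the cycle, i.e. joins two non-consecutive vertices of it. -/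
def HasChordedCycle {V : Type*} (G : SimpleGraph V) : Prop :=
  ∃ (v : V) (c : G.Walk v v), c.IsCycle ∧ ∃ e : Sym2 V, c.IsChord e

end SimpleGraph

/-! Scale a nonnegative eigenvector for `r = ρ(G)` so that its maximal entry is `x u = 1`. Counting
walks of length two from `u` gives `r² = ∑ y, codegree u y * x y`. Let `u` have `d` neighbours, `t`
of them on no triangle through `u`, and `f` vertices at distance at least two, so that `n = 1 + d +
f`. Without chorded cycles, adjacent vertices have at most one common neighbour, so `r² ≤ d + (d -
t) + ∑ far, codegree`, and `r² ≥ 2n - 4` forces the far sum to be at least `2f - 2 + t`. Short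
chorded cycles bound that sum from above: far vertices of codegree at least 3 have disjoint
neighbourhoods among the `t` triangle-free neighbours (`sum_codegree_filter_three_le`). If such a
vertex `w` exists, equality holds and `{u, w}` is the small part. If none exists and `t ≥ 2`,
equality makes the neighbourhood of `u` the small part. If `t ≤ 1`, all far codegrees are at most 1
and `r` is too small. -/

namespace SimpleGraph

/-! ### Chorded cycles of length at most six, and their absence from `K_{2,m}`. -/

variable {V : Type*} {G : SimpleGraph V}

theorem hasChordedCycle_of_cycle_four {a b c d : V} (hab : G.Adj a b) (hbc : G.Adj b c)
    (hcd : G.Adj c d) (hda : G.Adj d a) (hac : G.Adj a c) (hbd : b ≠ d) :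
    G.HasChordedCycle := by
  refine ⟨a, .cons hab (.cons hbc (.cons hcd (.cons hda .nil))), ?_, s(a, c), ?_⟩
  · have := hab.ne; have := hbc.ne; have := hcd.ne; have := hda.ne; have := hac.ne
    simp [Walk.cons_isCycle_iff, Walk.cons_isPath_iff]
    grind
  · have := hab.ne; have := hbc.ne; have := hcd.ne; have := hda.ne; have := hac.ne
    rw [Walk.isChord_sym2Mk]
    simp
    grind

theorem hasChordedCycle_of_cycle_five {a b c d e : V} (hab : G.Adj a b) (hbc : G.Adj b c)
    (hcd : G.Adj c d) (hde : G.Adj d e) (hea : G.Adj e a) (hac : G.Adj a c) (had : a ≠ d)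
    (hbd : b ≠ d) (hbe : b ≠ e) (hce : c ≠ e) : G.HasChordedCycle := by
  refine ⟨a, .cons hab (.cons hbc (.cons hcd (.cons hde (.cons hea .nil)))), ?_, s(a, c), ?_⟩
  · have := hab.ne; have := hbc.ne; have := hcd.ne; have := hde.ne; have := hea.ne
    have := hac.ne
    simp [Walk.cons_isCycle_iff, Walk.cons_isPath_iff]
    grind
  · have := hab.ne; have := hbc.ne; have := hcd.ne; have := hde.ne; have := hea.ne
    have := hac.ne
    rw [Walk.isChord_sym2Mk]
    simp
    grind

/-- A `6`-cycle `a b c d e f` with the long chord `ad`. -/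
theorem hasChordedCycle_of_cycle_six {a b c d e f : V} (hab : G.Adj a b) (hbc : G.Adj b c)
    (hcd : G.Adj c d) (hde : G.Adj d e) (hef : G.Adj e f) (hfa : G.Adj f a) (had : G.Adj a d)
    (hac : a ≠ c) (hae : a ≠ e) (hbd : b ≠ d) (hbe : b ≠ e) (hbf : b ≠ f) (hce : c ≠ e)
    (hcf : c ≠ f) (hdf : d ≠ f) : G.HasChordedCycle := by
  refine ⟨a, .cons hab (.cons hbc (.cons hcd (.cons hde (.cons hef (.cons hfa .nil))))), ?_,
    s(a, d), ?_⟩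
  · have := hab.ne; have := hbc.ne; have := hcd.ne; have := hde.ne; have := hef.ne
    have := hfa.ne; have := had.ne
    simp [Walk.cons_isCycle_iff, Walk.cons_isPath_iff]
    grind
  · have := hab.ne; have := hbc.ne; have := hcd.ne; have := hde.ne; have := hef.ne
    have := hfa.ne; have := had.ne
    rw [Walk.isChord_sym2Mk]
    simp
    grind

/-- The cycle already uses two edges at each of its vertices, so a vertex of degree at most two has
no edge left to serve as a chord. -/
theorem Walk.IsCycle.mem_edges_of_ncard_neighborSet_le_two {v r p : V} {c : G.Walk v v}
    (hc : c.IsCycle) (hr : r ∈ c.support) (hfin : (G.neighborSet r).Finite)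
    (h2 : (G.neighborSet r).ncard ≤ 2) (hrp : G.Adj r p) : s(r, p) ∈ c.edges := by
  have hsub : c.toSubgraph.neighborSet r ⊆ G.neighborSet r := c.toSubgraph.neighborSet_subset r
  have heq := Set.eq_of_subset_of_ncard_le hsub
    (h2.trans (hc.ncard_neighborSet_toSubgraph_eq_two hr).ge) hfin
  have hp : p ∈ c.toSubgraph.neighborSet r := by rw [heq]; exact hrp
  rw [← Walk.mem_edges_toSubgraph]
  exact hp

/-- If every edge has an endpoint of degree at most two, then all cycles are chordless. -/
theorem not_hasChordedCycle_of_forall_adj [Finite V]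
    (h : ∀ a b, G.Adj a b → (G.neighborSet a).ncard ≤ 2 ∨ (G.neighborSet b).ncard ≤ 2) :
    ¬ G.HasChordedCycle := by
  rintro ⟨v, c, hc, e, he⟩
  induction e with | _ a b
  rw [Walk.isChord_sym2Mk] at he
  obtain ⟨hab, hne, ha, hb⟩ := he
  rcases h a b hab with h2 | h2
  · exact hne (hc.mem_edges_of_ncard_neighborSet_le_two ha (Set.toFinite _) h2 hab)
  · apply hne
    rw [Sym2.eq_swap]
    exact hc.mem_edges_of_ncard_neighborSet_le_two hb (Set.toFinite _) h2 hab.symm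

theorem not_hasChordedCycle_of_iso_completeBipartiteGraph {m : ℕ}
    (φ : G ≃g completeBipartiteGraph (Fin 2) (Fin m)) : ¬ G.HasChordedCycle := by
  have : Finite V := Finite.of_equiv _ φ.symm.toEquiv
  have key : ∀ a j, φ a = Sum.inr j → (G.neighborSet a).ncard ≤ 2 := by
    intro a j ha
    have hsub : φ '' G.neighborSet a ⊆ Set.range Sum.inl := by
      rintro _ ⟨b, hb, rfl⟩
      have := φ.map_adj_iff.2 hb
      rw [ha] at this
      cases hφ : φ b <;> simp_all
    rw [← Set.ncard_image_of_injective _ φ.injective]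
    refine (Set.ncard_le_ncard hsub (Set.toFinite _)).trans ?_
    rw [← Set.image_univ, Set.ncard_image_of_injective _ Sum.inl_injective]
    simp
  refine not_hasChordedCycle_of_forall_adj fun a b hab => ?_
  have := φ.map_adj_iff.2 hab
  cases ha : φ a with
  | inr j => exact .inl (key a j ha)
  | inl i =>
    cases hb : φ b with
    | inr j => exact .inr (key b j hb)
    | inl j => simp [ha, hb] at this

/-- A graph whose edges are exactly the pairs split by a two-element set is `K_{2,n-2}`. -/
theorem nonempty_iso_completeBipartiteGraph_of_adj_iff [Fintype V] {n : ℕ}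
    (hV : Fintype.card V = n) {P : Finset V} (hP : P.card = 2)
    (h : ∀ a b, G.Adj a b ↔ ¬ (a ∈ P ↔ b ∈ P)) :
    Nonempty (G ≃g completeBipartiteGraph (Fin 2) (Fin (n - 2))) := by
  classical
  let e₁ : {a // a ∈ P} ≃ Fin 2 := Fintype.equivFinOfCardEq (by simpa using hP)
  let e₂ : {a // a ∉ P} ≃ Fin (n - 2) := Fintype.equivFinOfCardEq (by
    rw [Fintype.card_subtype_compl, hV]; simp [hP])
  refine ⟨⟨(Equiv.sumCompl (· ∈ P)).symm.trans (Equiv.sumCongr e₁ e₂), ?_⟩⟩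
  intro a b
  rw [h]
  by_cases ha : a ∈ P <;> by_cases hb : b ∈ P <;>
    simp [ha, hb, Equiv.sumCompl_symm_apply_of_pos, Equiv.sumCompl_symm_apply_of_neg]

end SimpleGraph

/-! ### Eigenvectors for the spectral radius, and its value for complete bipartite graphs. -/

namespace SimpleGraph

variable {V : Type*} [Fintype V] {G : SimpleGraph V}

open Classical in
theorem mem_spectrum_adjMatrix_iff {μ : ℝ} :
    μ ∈ spectrum ℝ (G.adjMatrix ℝ) ↔
      ∃ x : V → ℝ, x ≠ 0 ∧ ∀ v, ∑ w ∈ G.neighborFinset v, x w = μ * x v := by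
  rw [← Matrix.spectrum_toLin', ← Module.End.hasEigenvalue_iff_mem_spectrum]
  constructor
  · intro h
    obtain ⟨x, hx⟩ := h.exists_hasEigenvector
    refine ⟨x, hx.2, fun v => ?_⟩
    have := congrFun hx.apply_eq_smul v
    simpa [adjMatrix_mulVec_apply] using this
  · rintro ⟨x, hx0, hx⟩
    refine Module.End.hasEigenvalue_of_hasEigenvector (x := x)
      ⟨Module.End.mem_eigenspace_iff.2 ?_, hx0⟩
    ext v
    simpa [adjMatrix_mulVec_apply] using hx v

open Classical in
/-- The largest eigenvalue of the adjacency matrix has a nonnegative eigenvector. -/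
theorem exists_nonneg_eigenvector_adjSpectralRadius [Nonempty V] (G : SimpleGraph V) :
    ∃ x : V → ℝ, x ≠ 0 ∧ (∀ v, 0 ≤ x v) ∧
      ∀ v, ∑ w ∈ G.neighborFinset v, x w = G.adjSpectralRadius * x v := by
  obtain ⟨hmem, hub⟩ := G.isGreatest_adjSpectralRadius
  set r := G.adjSpectralRadius
  obtain ⟨x, hx0, hx⟩ := mem_spectrum_adjMatrix_iff.1 hmem
  -- `rI - A` is positive semidefinite because `r` is the largest eigenvalue. Its form at `|x|` is
  -- at most its form at `x`, which is zero, so `|x|` lies in the kernel.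
  set M : Matrix V V ℝ := algebraMap ℝ (Matrix V V ℝ) r - G.adjMatrix ℝ with hM
  have hpsd : M.PosSemidef := by
    rw [Matrix.posSemidef_iff_isHermitian_and_spectrum_nonneg]
    constructor
    · ext i j
      simp [hM, Matrix.algebraMap_matrix_apply, adjMatrix_apply, G.adj_comm, eq_comm]
    · rw [← spectrum.singleton_sub_eq]
      rintro _ ⟨_, rfl, μ, hμ, rfl⟩
      simpa using hub hμ
  have happ (y : V → ℝ) (v : V) : (M.mulVec y) v = r * y v - ∑ w ∈ G.neighborFinset v, y w := by
    simp [hM, Matrix.sub_mulVec, Algebra.algebraMap_eq_smul_one, Matrix.smul_mulVec,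
      adjMatrix_mulVec_apply]
  have hle : dotProduct (fun v => |x v|) (M.mulVec fun v => |x v|) ≤ 0 := by
    have h0 : ∑ v, x v * (r * x v - ∑ w ∈ G.neighborFinset v, x w) = 0 :=
      Finset.sum_eq_zero fun v _ => by rw [hx]; ring
    rw [← h0]
    simp only [dotProduct, happ]
    refine Finset.sum_le_sum fun v _ => ?_
    have h1 : |x v| * |x v| = x v * x v := abs_mul_abs_self _
    have h2 : x v * ∑ w ∈ G.neighborFinset v, x w
        ≤ |x v| * ∑ w ∈ G.neighborFinset v, |x w| := by
      refine (le_abs_self _).trans ?_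
      rw [abs_mul]
      exact mul_le_mul_of_nonneg_left (Finset.abs_sum_le_sum_abs _ _) (abs_nonneg _)
    linear_combination h2 + r * h1
  have hzero := (hpsd.dotProduct_mulVec_zero_iff fun v => |x v|).1
    (le_antisymm (by simpa using hle) (hpsd.dotProduct_mulVec_nonneg _))
  refine ⟨fun v => |x v|, fun h => hx0 ?_, fun v => abs_nonneg _, fun v => ?_⟩
  · ext v
    simpa using congrFun h v
  · have := congrFun hzero v
    rw [happ] at this
    simp only [Pi.zero_apply] at this
    linarith

open Classical in
/-- A nonnegative eigenvector for the spectral radius, scaled to have maximal entry `1`. -/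
theorem exists_eigenvector_adjSpectralRadius_le_one [Nonempty V] (G : SimpleGraph V) :
    ∃ (x : V → ℝ) (u : V), x u = 1 ∧ (∀ v, 0 ≤ x v) ∧ (∀ v, x v ≤ 1) ∧
      ∀ v, ∑ w ∈ G.neighborFinset v, x w = G.adjSpectralRadius * x v := by
  obtain ⟨x, hx0, hnn, hx⟩ := G.exists_nonneg_eigenvector_adjSpectralRadius
  obtain ⟨u, hu⟩ := Finite.exists_max x
  have hpos : 0 < x u := by
    obtain ⟨v, hv⟩ := Function.ne_iff.1 hx0
    exact (lt_of_le_of_ne (hnn v) (Ne.symm hv)).trans_le (hu v)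
  refine ⟨fun v => x v / x u, u, div_self hpos.ne', fun v => div_nonneg (hnn v) hpos.le,
    fun v => (div_le_one hpos).2 (hu v), fun v => ?_⟩
  rw [← Finset.sum_div, hx, mul_div_assoc]

theorem adjSpectralRadius_completeBipartiteGraph {m k : ℕ} (hm : 0 < m) (hk : 0 < k) :
    (completeBipartiteGraph (Fin m) (Fin k)).adjSpectralRadius = √(m * k) := by
  classical
  have : Nonempty (Fin m ⊕ Fin k) := ⟨.inl ⟨0, hm⟩⟩
  have hsum (x : Fin m ⊕ Fin k → ℝ) (v : Fin m ⊕ Fin k) :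
      ∑ w ∈ (completeBipartiteGraph (Fin m) (Fin k)).neighborFinset v, x w =
        v.elim (fun _ => ∑ j, x (.inr j)) (fun _ => ∑ i, x (.inl i)) := by
    rw [neighborFinset_eq_filter, Finset.sum_filter, Fintype.sum_sum_type]
    cases v <;> simp
  have hm' : (0 : ℝ) < m := by exact_mod_cast hm
  have hk' : (0 : ℝ) < k := by exact_mod_cast hk
  have hsq : √((m : ℝ) * k) * √((m : ℝ) * k) = m * k := Real.mul_self_sqrt (by positivity)
  refine (isGreatest_adjSpectralRadius _).unique ⟨?_, ?_⟩
  · rw [mem_spectrum_adjMatrix_iff]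
    refine ⟨Sum.elim (fun _ => √((m : ℝ) * k)) (fun _ => m), fun h => ?_, fun v => ?_⟩
    · have := congrFun h (.inr ⟨0, hk⟩)
      simp at this
      omega
    · convert hsum _ v using 1
      cases v
      · simpa [mul_comm] using hsq
      · simp [mul_comm]
  · intro μ hμ
    obtain ⟨x, hx0, hx⟩ := mem_spectrum_adjMatrix_iff.1 hμ
    have hx' (v) := (hsum x v).symm.trans (by convert hx v)
    have hl (i : Fin m) : ∑ j, x (.inr j) = μ * x (.inl i) := hx' (.inl i)
    have hr (j : Fin k) : ∑ i, x (.inl i) = μ * x (.inr j) := hx' (.inr j)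
    have hL : μ * ∑ i, x (.inl i) = m * ∑ j, x (.inr j) := by
      rw [Finset.mul_sum, Finset.sum_congr rfl fun i _ => (hl i).symm]; simp
    have hR : μ * ∑ j, x (.inr j) = k * ∑ i, x (.inl i) := by
      rw [Finset.mul_sum, Finset.sum_congr rfl fun i _ => (hr i).symm]; simp
    apply Real.le_sqrt_of_sq_le
    -- `hL` and `hR` give `μ² S = m k S` for the left sum `S`. If `S = 0`, both sums vanish and a
    -- nonzero `μ` would kill every entry.
    by_cases hS : ∑ i, x (.inl i) = 0
    · have hS' : ∑ j, x (.inr j) = 0 := by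
        rw [hS, mul_zero] at hL
        exact (mul_eq_zero.1 hL.symm).resolve_left hm'.ne'
      have : μ = 0 := by
        by_contra hμ0
        apply hx0
        ext v
        cases v with
        | inl i => simpa [hS', hμ0] using (hl i).symm
        | inr j => simpa [hS, hμ0] using (hr j).symm
      rw [this, zero_pow two_ne_zero]
      positivity
    · apply le_of_eq
      apply mul_right_cancel₀ hS
      linear_combination μ * hL + m * hR

end SimpleGraph

/-! ### Codegrees in graphs without chorded cycles, and the count of walks of length two. -/

namespace SimpleGraph

variable {V : Type*} [Fintype V] {G : SimpleGraph V}

open Classical in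
/-- The number of common neighbours of two vertices. -/
noncomputable def codegree (G : SimpleGraph V) (u y : V) : ℕ :=
  (G.neighborFinset u ∩ G.neighborFinset y).card

open Classical in
theorem codegree_self_eq_card (u : V) : G.codegree u u = (G.neighborFinset u).card := by
  simp [codegree]

theorem exists_common_neighbor_ne {u y : V} (h : 2 ≤ G.codegree u y) (a : V) :
    ∃ c, G.Adj u c ∧ G.Adj y c ∧ c ≠ a := by
  obtain ⟨c, hc, hca⟩ := Finset.exists_mem_ne (Nat.lt_of_succ_le h) a
  simp only [Finset.mem_inter, mem_neighborFinset] at hc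
  exact ⟨c, hc.1, hc.2, hca⟩

theorem exists_common_neighbor_ne_ne {u y : V} (h : 3 ≤ G.codegree u y) (a b : V) :
    ∃ c, G.Adj u c ∧ G.Adj y c ∧ c ≠ a ∧ c ≠ b := by
  classical
  have hlt : ({a, b} : Finset V).card < G.codegree u y := Finset.card_le_two.trans_lt h
  obtain ⟨c, hc, hcn⟩ := Finset.exists_mem_notMem_of_card_lt_card hlt
  simp only [Finset.mem_inter, mem_neighborFinset] at hc
  simp only [Finset.mem_insert, Finset.mem_singleton, not_or] at hcn
  exact ⟨c, hc.1, hc.2, hcn.1, hcn.2⟩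

theorem exists_common_neighbor {u y : V} (h : G.codegree u y ≠ 0) :
    ∃ c, G.Adj u c ∧ G.Adj y c := by
  obtain ⟨c, hc⟩ := Finset.card_pos.1 (Nat.pos_of_ne_zero h)
  simp only [Finset.mem_inter, mem_neighborFinset] at hc
  exact ⟨c, hc.1, hc.2⟩

/-- Two common neighbours of the ends of an edge form a 4-cycle with that edge as chord. -/
theorem codegree_le_one_of_adj (hG : ¬ G.HasChordedCycle) {u v : V} (huv : G.Adj u v) :
    G.codegree u v ≤ 1 := by
  by_contra! h
  obtain ⟨a, hua, hva, -⟩ := exists_common_neighbor_ne h u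
  obtain ⟨b, hub, hvb, hba⟩ := exists_common_neighbor_ne h a
  exact hG (hasChordedCycle_of_cycle_four hua hva.symm hvb hub.symm huv hba.symm)

/-- A vertex of a triangle `u a b` is not adjacent to any vertex at distance two from `u` having
two common neighbours with `u`. -/
theorem codegree_eq_zero_of_two_le_codegree (hG : ¬ G.HasChordedCycle) {u w a : V} (huw : u ≠ w)
    (hnuw : ¬ G.Adj u w) (h2 : 2 ≤ G.codegree u w) (hua : G.Adj u a) (hwa : G.Adj w a) :
    G.codegree u a = 0 := by
  by_contra h
  obtain ⟨b, hub, hab⟩ := exists_common_neighbor h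
  obtain ⟨c, huc, hwc, hca⟩ := exists_common_neighbor_ne h2 a
  -- The chorded cycle is `a u b w` with chord `ab` if `c = b`, and otherwise `u b a w c` with chord
  -- `ua`.
  by_cases hcb : c = b
  · subst hcb
    exact hG (hasChordedCycle_of_cycle_four hua.symm huc hwc.symm hwa hab huw)
  · refine hG (hasChordedCycle_of_cycle_five hub hab.symm hwa.symm hwc huc.symm hua huw ?_
      (Ne.symm hcb) hca.symm)
    rintro rfl
    exact hnuw hub

/-- A second common neighbour `c` of `u` and `w'` would give the 6-cycle `u c w' b w d` with chord
`ub`; three common neighbours of `u` and `w` leave room for `d` to avoid `b` and `c`. -/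
theorem codegree_le_one_of_three_le_codegree (hG : ¬ G.HasChordedCycle) {u w w' b : V}
    (huw : u ≠ w) (hnuw : ¬ G.Adj u w) (huw' : u ≠ w') (hnuw' : ¬ G.Adj u w') (hww' : w ≠ w')
    (h3 : 3 ≤ G.codegree u w) (hub : G.Adj u b) (hwb : G.Adj w b) (hwb' : G.Adj w' b) :
    G.codegree u w' ≤ 1 := by
  by_contra! h
  obtain ⟨c, huc, hwc, hcb⟩ := exists_common_neighbor_ne h b
  obtain ⟨d, hud, hwd, hdb, hdc⟩ := exists_common_neighbor_ne_ne h3 b c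
  refine hG (hasChordedCycle_of_cycle_six huc hwc.symm hwb' hwb.symm hwd hud.symm hub huw' huw
    hcb ?_ hdc.symm hww'.symm ?_ hdb.symm)
  · rintro rfl
    exact hnuw huc
  · rintro rfl
    exact hnuw' hud

open Classical in
/-- The square of an eigenvalue, read off at an entry `1` of the eigenvector by counting walks of
length two. -/
theorem sq_eigenvalue_eq_sum_codegree {x : V → ℝ} {r : ℝ} {u : V} (hu : x u = 1)
    (hx : ∀ v, ∑ w ∈ G.neighborFinset v, x w = r * x v) :
    r ^ 2 = ∑ y, G.codegree u y * x y := by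
  calc r ^ 2 = r * (r * x u) := by rw [hu]; ring
    _ = ∑ v ∈ G.neighborFinset u, ∑ y ∈ G.neighborFinset v, x y := by
      rw [← hx u, Finset.mul_sum]
      exact Finset.sum_congr rfl fun v _ => (hx v).symm
    _ = ∑ v ∈ G.neighborFinset u, ∑ y, if G.Adj v y then x y else 0 := by
      simp only [neighborFinset_eq_filter, Finset.sum_filter]
    _ = ∑ y, ∑ v ∈ G.neighborFinset u, if G.Adj v y then x y else 0 := Finset.sum_comm
    _ = ∑ y, G.codegree u y * x y := by
      refine Finset.sum_congr rfl fun y _ => ?_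
      rw [← Finset.sum_filter, Finset.sum_const, nsmul_eq_mul]
      congr 2
      unfold codegree
      congr 1
      ext v
      simp [G.adj_comm]

open Classical in
/-- The vertices other than `u` that are not adjacent to `u`. -/
noncomputable def farFinset (G : SimpleGraph V) (u : V) : Finset V :=
  Finset.univ.filter fun w => u ≠ w ∧ ¬ G.Adj u w

theorem mem_farFinset {u w : V} : w ∈ G.farFinset u ↔ u ≠ w ∧ ¬ G.Adj u w := by
  simp [farFinset]

open Classical in
theorem sum_univ_eq_add_neighborFinset_add_farFinset {M : Type*} [AddCommMonoid M] (u : V)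
    (f : V → M) :
    ∑ y, f y = f u + (∑ y ∈ G.neighborFinset u, f y + ∑ y ∈ G.farFinset u, f y) := by
  have h1 : Disjoint (G.neighborFinset u) (G.farFinset u) := by
    rw [Finset.disjoint_left]
    intro a ha hb
    exact (mem_farFinset.1 hb).2 ((mem_neighborFinset _ _ _).1 ha)
  have h2 : u ∉ G.neighborFinset u ∪ G.farFinset u := by simp [mem_farFinset]
  rw [← Finset.sum_union h1, ← Finset.sum_insert h2]
  refine Finset.sum_congr ?_ fun _ _ => rfl
  ext y
  simp only [Finset.mem_univ, Finset.mem_insert, Finset.mem_union, mem_neighborFinset,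
    mem_farFinset, true_iff]
  tauto

open Classical in
/-- If the nonneighbours of `u` all have two common neighbours with `u`, and the eigenvector is
maximal on the triangles at `u`, then there are no triangles at `u`. -/
theorem codegree_eq_zero_of_forall_two_le (hG : ¬ G.HasChordedCycle) {x : V → ℝ} {r : ℝ} {u : V}
    (hle : ∀ v, x v ≤ 1) (hx : ∀ v, ∑ w ∈ G.neighborFinset v, x w = r * x v) (hr : 2 < r)
    (hW : ∀ w ∈ G.farFinset u, 2 ≤ G.codegree u w)
    (hN : ∀ v, G.Adj u v → G.codegree u v ≠ 0 → x v = 1) {v : V} (hv : G.Adj u v) :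
    G.codegree u v = 0 := by
  by_contra h
  -- A neighbour of `v` outside this set would be a far vertex of codegree at least 2, excluded
  -- because `v` lies on a triangle at `u`. Hence `v` has degree at most 2, while `x v = 1` requires
  -- degree at least `r > 2`.
  have hsub : G.neighborFinset v ⊆ insert u (G.neighborFinset u ∩ G.neighborFinset v) := by
    intro y hy
    rw [mem_neighborFinset] at hy
    by_contra hn
    simp only [Finset.mem_insert, Finset.mem_inter, mem_neighborFinset, hy, and_true,
      not_or] at hn
    exact h (codegree_eq_zero_of_two_le_codegree hG (Ne.symm hn.1) hn.2
      (hW y (mem_farFinset.2 ⟨Ne.symm hn.1, hn.2⟩)) hv hy.symm)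
  have hcard : (G.neighborFinset v).card ≤ 2 :=
    (Finset.card_le_card hsub).trans ((Finset.card_insert_le _ _).trans
      (Nat.succ_le_succ (codegree_le_one_of_adj hG hv)))
  have h1 : r ≤ (G.neighborFinset v).card := by
    have := hx v
    rw [hN v hv h, mul_one] at this
    rw [← this]
    simpa using Finset.sum_le_card_nsmul (G.neighborFinset v) x 1 fun y _ => hle y
  have : ((G.neighborFinset v).card : ℝ) ≤ 2 := by exact_mod_cast hcard
  linarith

end SimpleGraph

/-! ### Upper bounds for the codegree sums and the equality cases. -/

namespace SimpleGraph

variable {V : Type*} [Fintype V] {G : SimpleGraph V}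

open Classical in
/-- The neighbours of `u` that lie on no triangle through `u`. -/
noncomputable def triangleFreeNeighborFinset (G : SimpleGraph V) (u : V) : Finset V :=
  (G.neighborFinset u).filter fun v => G.codegree u v = 0

theorem mem_triangleFreeNeighborFinset {u v : V} :
    v ∈ G.triangleFreeNeighborFinset u ↔ G.Adj u v ∧ G.codegree u v = 0 := by
  simp [triangleFreeNeighborFinset]

open Classical in
theorem sum_codegree_neighborFinset_add_card_le (hG : ¬ G.HasChordedCycle) (u : V) :
    ∑ v ∈ G.neighborFinset u, G.codegree u v + (G.triangleFreeNeighborFinset u).card ≤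
      (G.neighborFinset u).card := by
  rw [triangleFreeNeighborFinset, Finset.card_filter, ← Finset.sum_add_distrib,
    Finset.card_eq_sum_ones]
  refine Finset.sum_le_sum fun v hv => ?_
  have := codegree_le_one_of_adj hG ((mem_neighborFinset _ _ _).1 hv)
  split_ifs <;> omega

open Classical in
theorem inter_neighborFinset_subset_triangleFree (hG : ¬ G.HasChordedCycle) {u w : V}
    (hw : w ∈ G.farFinset u) (h2 : 2 ≤ G.codegree u w) :
    G.neighborFinset u ∩ G.neighborFinset w ⊆ G.triangleFreeNeighborFinset u := by
  intro a ha
  simp only [Finset.mem_inter, mem_neighborFinset] at ha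
  rw [mem_farFinset] at hw
  exact mem_triangleFreeNeighborFinset.2
    ⟨ha.1, codegree_eq_zero_of_two_le_codegree hG hw.1 hw.2 h2 ha.1 ha.2⟩

open Classical in
/-- Nonneighbours of `u` with at least three common neighbours with `u` have disjoint
neighbourhoods inside the neighbourhood of `u`. -/
theorem sum_codegree_filter_three_le (hG : ¬ G.HasChordedCycle) (u : V) :
    ∑ w ∈ (G.farFinset u).filter (fun w => 3 ≤ G.codegree u w), G.codegree u w ≤
      (G.triangleFreeNeighborFinset u).card := by
  have hdisj : ∀ w ∈ (G.farFinset u).filter (fun w => 3 ≤ G.codegree u w),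
      ∀ w' ∈ (G.farFinset u).filter (fun w => 3 ≤ G.codegree u w), w ≠ w' →
        Disjoint (G.neighborFinset u ∩ G.neighborFinset w)
          (G.neighborFinset u ∩ G.neighborFinset w') := by
    intro w hw w' hw' hne
    rw [Finset.mem_filter, mem_farFinset] at hw hw'
    rw [Finset.disjoint_left]
    intro b hb hb'
    simp only [Finset.mem_inter, mem_neighborFinset] at hb hb'
    have := codegree_le_one_of_three_le_codegree hG hw.1.1 hw.1.2 hw'.1.1 hw'.1.2 hne hw.2 hb.1
      hb.2 hb'.2
    omega
  have := Finset.card_biUnion hdisj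
  unfold codegree at this ⊢
  rw [← this]
  refine Finset.card_le_card (Finset.biUnion_subset.2 fun w hw => ?_)
  rw [Finset.mem_filter] at hw
  exact inter_neighborFinset_subset_triangleFree hG hw.1 (le_trans (by norm_num) hw.2)

theorem adj_of_card_le_codegree [DecidableRel G.Adj] {u w b : V}
    (h : (G.neighborFinset u).card ≤ G.codegree u w)
    (hb : G.Adj u b) : G.Adj w b := by
  classical
  have h' : G.neighborFinset u ∩ G.neighborFinset w = G.neighborFinset u :=
    Finset.eq_of_subset_of_card_le Finset.inter_subset_left (by
      unfold codegree at h; convert h)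
  have : b ∈ G.neighborFinset u ∩ G.neighborFinset w := by rw [h']; simpa using hb
  simpa using (Finset.mem_inter.1 this).2

open Classical in
theorem card_eq_one_add_card_neighborFinset_add_card_farFinset (u : V) :
    Fintype.card V = 1 + ((G.neighborFinset u).card + (G.farFinset u).card) := by
  simpa using sum_univ_eq_add_neighborFinset_add_farFinset (G := G) u (fun _ => (1 : ℕ))

open Classical in
theorem sq_eigenvalue_eq_card_add {x : V → ℝ} {r : ℝ} {u : V} (hu : x u = 1)
    (hx : ∀ v, ∑ w ∈ G.neighborFinset v, x w = r * x v) :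
    r ^ 2 = (G.neighborFinset u).card + (∑ v ∈ G.neighborFinset u, G.codegree u v * x v +
      ∑ w ∈ G.farFinset u, G.codegree u w * x w) := by
  rw [sq_eigenvalue_eq_sum_codegree hu hx, sum_univ_eq_add_neighborFinset_add_farFinset (G := G) u,
    hu, mul_one, codegree_self_eq_card]

theorem sum_natCast_mul_le {ι : Type*} {x : ι → ℝ} (hle : ∀ v, x v ≤ 1) (s : Finset ι)
    (f : ι → ℕ) : ∑ v ∈ s, (f v : ℝ) * x v ≤ (∑ v ∈ s, f v : ℕ) := by
  rw [Nat.cast_sum]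
  exact Finset.sum_le_sum fun v _ => mul_le_of_le_one_right (Nat.cast_nonneg _) (hle v)

open Classical in
/-- The equality case of the two-step walk count. -/
theorem codegree_sum_eq_of_le_sq (hG : ¬ G.HasChordedCycle) {n : ℕ} (hV : Fintype.card V = n)
    {x : V → ℝ} {r : ℝ} {u : V} (hu : x u = 1) (hle : ∀ v, x v ≤ 1)
    (hx : ∀ v, ∑ w ∈ G.neighborFinset v, x w = r * x v) (hr : 2 * (n : ℝ) - 4 ≤ r ^ 2)
    (hB : ∑ w ∈ G.farFinset u, G.codegree u w + 2 ≤
      2 * (G.farFinset u).card + (G.triangleFreeNeighborFinset u).card) :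
    ∑ w ∈ G.farFinset u, G.codegree u w + 2 =
      2 * (G.farFinset u).card + (G.triangleFreeNeighborFinset u).card ∧
    ∀ v, G.Adj u v → G.codegree u v ≠ 0 → x v = 1 := by
  have hsq := sq_eigenvalue_eq_card_add hu hx
  have hc := card_eq_one_add_card_neighborFinset_add_card_farFinset (G := G) u
  rw [hV] at hc
  have hN := sum_codegree_neighborFinset_add_card_le hG u
  have hNx := sum_natCast_mul_le hle (G.neighborFinset u) (G.codegree u)
  have hWx := sum_natCast_mul_le hle (G.farFinset u) (G.codegree u)
  have hc' : (n : ℝ) = 1 + ((G.neighborFinset u).card + (G.farFinset u).card) := by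
    exact_mod_cast hc
  have hN' : ((∑ v ∈ G.neighborFinset u, G.codegree u v : ℕ) : ℝ) +
      (G.triangleFreeNeighborFinset u).card ≤ (G.neighborFinset u).card := by exact_mod_cast hN
  have hB' : ((∑ w ∈ G.farFinset u, G.codegree u w : ℕ) : ℝ) + 2 ≤
      2 * (G.farFinset u).card + (G.triangleFreeNeighborFinset u).card := by exact_mod_cast hB
  -- Under `hB` the walk count is at most `2n - 4`, so every estimate in it is tight, including the
  -- replacement of `x v` by 1 wherever the codegree is nonzero.
  constructor
  · have : 2 * ((G.farFinset u).card : ℝ) + (G.triangleFreeNeighborFinset u).card ≤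
        ((∑ w ∈ G.farFinset u, G.codegree u w : ℕ) : ℝ) + 2 := by linarith
    exact le_antisymm hB (by exact_mod_cast this)
  · intro v hv h0
    have heq : ∑ v ∈ G.neighborFinset u, (G.codegree u v : ℝ) * x v =
        ∑ v ∈ G.neighborFinset u, (G.codegree u v : ℝ) := by
      rw [← Nat.cast_sum]
      linarith
    have := (Finset.sum_eq_sum_iff_of_le fun v _ =>
      mul_le_of_le_one_right (Nat.cast_nonneg (G.codegree u v)) (hle v)).1 heq v (by simpa using hv)
    exact mul_left_cancel₀ (Nat.cast_ne_zero.2 h0) (this.trans (mul_one _).symm)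

open Classical in
/-- A graph without chorded cycles on `n ≥ 6` vertices whose largest eigenvalue is at least
`√(2n - 4)` is complete bipartite with a part of size two. -/
theorem exists_card_eq_two_adj_iff (hG : ¬ G.HasChordedCycle) {n : ℕ} (hn : 6 ≤ n)
    (hV : Fintype.card V = n) {x : V → ℝ} {r : ℝ} {u : V} (hu : x u = 1) (hnn : ∀ v, 0 ≤ x v)
    (hle : ∀ v, x v ≤ 1) (hx : ∀ v, ∑ w ∈ G.neighborFinset v, x w = r * x v) (hr0 : 0 ≤ r)
    (hr : 2 * (n : ℝ) - 4 ≤ r ^ 2) :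
    ∃ P : Finset V, P.card = 2 ∧ ∀ a b, G.Adj a b ↔ ¬ (a ∈ P ↔ b ∈ P) := by
  have hn' : (6 : ℝ) ≤ n := by exact_mod_cast hn
  have hr2 : 2 < r := by nlinarith
  have hc := card_eq_one_add_card_neighborFinset_add_card_farFinset (G := G) u
  rw [hV] at hc
  have htight := codegree_sum_eq_of_le_sq hG hV hu hle hx hr
  have hind : (∀ w ∈ G.farFinset u, 2 ≤ G.codegree u w) →
      (∀ v, G.Adj u v → G.codegree u v ≠ 0 → x v = 1) →
      (∀ a b, G.Adj u a → G.Adj u b → ¬ G.Adj a b) ∧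
        G.triangleFreeNeighborFinset u = G.neighborFinset u := by
    intro hW hN
    have h0 : ∀ v, G.Adj u v → G.codegree u v = 0 := fun v hv =>
      codegree_eq_zero_of_forall_two_le hG hle hx hr2 hW hN hv
    constructor
    · intro a b ha hb hab
      have := Finset.card_eq_zero.1 (h0 a ha)
      have hmem : b ∈ G.neighborFinset u ∩ G.neighborFinset a := by simp [hb, hab]
      simp [this] at hmem
    · ext v
      rw [mem_triangleFreeNeighborFinset, mem_neighborFinset]
      exact ⟨And.left, fun h => ⟨h, h0 v h⟩⟩
  by_cases hK : ∃ w ∈ G.farFinset u, 3 ≤ G.codegree u w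
  · obtain ⟨w, hwW, hw3⟩ := hK
    have hKs := sum_codegree_filter_three_le hG u
    have hsplit := Finset.sum_filter_add_sum_filter_not (G.farFinset u)
      (fun w => 3 ≤ G.codegree u w) (G.codegree u)
    have hsplit' := Finset.card_filter_add_card_filter_not (s := G.farFinset u)
      (fun w => 3 ≤ G.codegree u w)
    have hwK : w ∈ (G.farFinset u).filter (fun w => 3 ≤ G.codegree u w) :=
      Finset.mem_filter.2 ⟨hwW, hw3⟩
    have hK1 := Finset.card_pos.2 ⟨w, hwK⟩
    have hle2 : ∀ y ∈ (G.farFinset u).filter (fun w => ¬ 3 ≤ G.codegree u w),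
        G.codegree u y ≤ 2 := fun y hy => by
      have := (Finset.mem_filter.1 hy).2
      omega
    have hrest := Finset.sum_le_card_nsmul _ (fun y => G.codegree u y) _ hle2
    rw [smul_eq_mul] at hrest
    -- Vertices of codegree at least 3 contribute at most `t` in total and the others at most 2
    -- each; as `w` is not among the latter, the far sum is at most `2(f - 1) + t`.
    obtain ⟨heq, hN⟩ := htight (by omega)
    have hsumeq : ∑ y ∈ (G.farFinset u).filter (fun w => ¬ 3 ≤ G.codegree u w), G.codegree u y =
        ∑ y ∈ (G.farFinset u).filter (fun w => ¬ 3 ≤ G.codegree u w), 2 := by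
      rw [Finset.sum_const, smul_eq_mul]
      omega
    have hW : ∀ y ∈ G.farFinset u, 2 ≤ G.codegree u y := by
      intro y hy
      by_cases h3 : 3 ≤ G.codegree u y
      · omega
      · exact ((Finset.sum_eq_sum_iff_of_le hle2).1 hsumeq y (Finset.mem_filter.2 ⟨hy, h3⟩)).ge
    obtain ⟨hindN, hTN⟩ := hind hW hN
    have hKone : (G.farFinset u).filter (fun w => 3 ≤ G.codegree u w) = {w} := by
      obtain ⟨w', hw'⟩ := Finset.card_eq_one.1
        (show ((G.farFinset u).filter (fun w => 3 ≤ G.codegree u w)).card = 1 by omega)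
      rw [hw'] at hwK ⊢
      rw [Finset.mem_singleton.1 hwK]
    have hfw : (G.neighborFinset u).card ≤ G.codegree u w := by
      rw [hKone, Finset.sum_singleton] at hsplit
      rw [hKone, Finset.card_singleton] at hsplit'
      rw [hTN] at heq
      omega
    have hwN : ∀ b, G.Adj u b → G.Adj w b := fun b hb => adj_of_card_le_codegree hfw hb
    obtain ⟨huw, hnuw⟩ := mem_farFinset.1 hwW
    -- Another far vertex has codegree at least 2, yet shares with `w` a neighbour of `u`, which
    -- limits its codegree to 1.
    have huniq : ∀ y, u ≠ y → ¬ G.Adj u y → y = w := by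
      intro y huy hnuy
      by_contra hyw
      have hy2 := hW y (mem_farFinset.2 ⟨huy, hnuy⟩)
      obtain ⟨b, hub, hyb, -⟩ := exists_common_neighbor_ne hy2 u
      have := codegree_le_one_of_three_le_codegree hG huw hnuw huy hnuy (Ne.symm hyw) hw3 hub
        (hwN b hub) hyb
      omega
    have hcases : ∀ y, y = u ∨ y = w ∨ (G.Adj u y ∧ G.Adj w y ∧ y ≠ u ∧ y ≠ w) := by
      intro y
      by_cases h1 : u = y
      · exact .inl h1.symm
      by_cases h2 : G.Adj u y
      · exact .inr (.inr ⟨h2, hwN y h2, h2.ne', (hwN y h2).ne'⟩)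
      · exact .inr (.inl (huniq y h1 h2))
    refine ⟨{u, w}, Finset.card_pair huw, fun a b => ?_⟩
    simp only [Finset.mem_insert, Finset.mem_singleton]
    have hirr (v : V) : ¬ G.Adj v v := G.irrefl
    have hab := G.adj_comm a b
    have hindab := hindN a b
    have hwu := fun h : G.Adj w u => hnuw h.symm
    clear * - hirr hab hindab hwu hcases huw hnuw
    rcases hcases a with rfl | rfl | ha <;> rcases hcases b with rfl | rfl | hb <;> grind
  · push Not at hK
    by_cases hs : 2 ≤ (G.triangleFreeNeighborFinset u).card
    · have hle2 : ∀ y ∈ G.farFinset u, G.codegree u y ≤ 2 := fun y hy => by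
        have := hK y hy
        omega
      have hrest := Finset.sum_le_card_nsmul _ (fun y => G.codegree u y) _ hle2
      rw [smul_eq_mul] at hrest
      -- Here the far sum is at most `2f`, and `t ≥ 2` supplies the `+ 2`; equality then forces `t =
      -- 2` and every far codegree to be 2.
      obtain ⟨heq, hN⟩ := htight (by omega)
      have hsumeq : ∑ y ∈ G.farFinset u, G.codegree u y = ∑ y ∈ G.farFinset u, 2 := by
        rw [Finset.sum_const, smul_eq_mul]
        omega
      have hW2 := (Finset.sum_eq_sum_iff_of_le hle2).1 hsumeq
      obtain ⟨hindN, hTN⟩ := hind (fun y hy => (hW2 y hy).ge) hN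
      have hd : (G.neighborFinset u).card = 2 := by
        rw [← hTN]
        omega
      have hfar : ∀ y ∈ G.farFinset u, ∀ b, G.Adj u b → G.Adj y b := fun y hy b hb =>
        adj_of_card_le_codegree (by rw [hd, hW2 y hy]) hb
      have hall : ∀ y, ¬ G.Adj u y → ∀ b, G.Adj u b → G.Adj y b := by
        intro y hy b hb
        by_cases h1 : u = y
        · exact h1 ▸ hb
        · exact hfar y (mem_farFinset.2 ⟨h1, hy⟩) b hb
      obtain ⟨p, q, hpq, hNpq⟩ := Finset.card_eq_two.1 hd
      have hup : G.Adj u p := by rw [← mem_neighborFinset, hNpq]; simp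
      have huq : G.Adj u q := by rw [← mem_neighborFinset, hNpq]; simp
      have hindW : ∀ a b, ¬ G.Adj u a → ¬ G.Adj u b → ¬ G.Adj a b := by
        intro a b ha hb hab
        have hua : u ≠ a := by rintro rfl; exact hb hab
        have hub : u ≠ b := by rintro rfl; exact ha hab.symm
        exact hG (hasChordedCycle_of_cycle_five hab (hall b hb p hup) hup.symm huq
          (hall a ha q huq).symm (hall a ha p hup) hua.symm hub.symm
          (by rintro rfl; exact hb huq) hpq)
      refine ⟨G.neighborFinset u, hd, fun a b => ?_⟩
      simp only [mem_neighborFinset]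
      by_cases ha : G.Adj u a <;> by_cases hb : G.Adj u b
      · simp [ha, hb, hindN a b ha hb]
      · simp [ha, hb, (hall b hb a ha).symm]
      · simp [ha, hb, hall a ha b hb]
      · simp [ha, hb, hindW a b ha hb]
    · exfalso
      have hW1 : ∀ w ∈ G.farFinset u, G.codegree u w ≤ 1 := by
        intro w hw
        by_contra! h2
        exact hs ((Nat.succ_le_of_lt h2).trans
          (Finset.card_le_card (inter_neighborFinset_subset_triangleFree hG hw h2)))
      have hsq := sq_eigenvalue_eq_card_add hu hx
      -- Keeping the weights `x v` bounds this sum by `r`, through the eigenvalue equation at `u`,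
      -- rather than by `d`.
      have hNx : ∑ v ∈ G.neighborFinset u, (G.codegree u v : ℝ) * x v ≤ r := by
        have hxu := hx u
        rw [hu, mul_one] at hxu
        rw [← hxu]
        refine Finset.sum_le_sum fun v hv => mul_le_of_le_one_left (hnn v) ?_
        exact_mod_cast codegree_le_one_of_adj hG (by simpa using hv)
      have hWx := sum_natCast_mul_le hle (G.farFinset u) (G.codegree u)
      have hWc : ((∑ w ∈ G.farFinset u, G.codegree u w : ℕ) : ℝ) ≤ (G.farFinset u).card := by
        have := Finset.sum_le_card_nsmul _ (fun w => G.codegree u w) _ hW1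
        rw [smul_eq_mul, mul_one] at this
        exact_mod_cast this
      have hc' : (n : ℝ) = 1 + ((G.neighborFinset u).card + (G.farFinset u).card) := by
        exact_mod_cast hc
      have h1 : r ^ 2 ≤ n - 1 + r := by linarith
      -- With `h1` this gives `(n - 3)(n - 4) ≤ n - 1`, which fails from `n = 6` on but not at `n =
      -- 5`.
      have h2 : (n : ℝ) - 3 ≤ r := by linarith
      nlinarith

end SimpleGraph

theorem theorem1 {V : Type*} [Fintype V] (G : SimpleGraph V) (n : ℕ) (hn : 6 ≤ n)
    (hV : Fintype.card V = n) :
    (completeBipartiteGraph (Fin 2) (Fin (n - 2))).adjSpectralRadius = √(2 * (n : ℝ) - 4) ∧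
      ((completeBipartiteGraph (Fin 2) (Fin (n - 2))).adjSpectralRadius ≤ G.adjSpectralRadius →
        (G.HasChordedCycle ↔
          ¬ Nonempty (G ≃g completeBipartiteGraph (Fin 2) (Fin (n - 2))))) := by
  have hρ : (completeBipartiteGraph (Fin 2) (Fin (n - 2))).adjSpectralRadius =
      √(2 * (n : ℝ) - 4) := by
    rw [SimpleGraph.adjSpectralRadius_completeBipartiteGraph two_pos (by omega),
      Nat.cast_sub (by omega)]
    congr 1
    push_cast
    ring
  refine ⟨hρ, fun hle => ⟨?_, fun hiso => ?_⟩⟩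
  · rintro h ⟨φ⟩
    exact SimpleGraph.not_hasChordedCycle_of_iso_completeBipartiteGraph φ h
  · by_contra hG
    have : Nonempty V := Fintype.card_pos_iff.1 (by omega)
    obtain ⟨x, u, hu, hnn, hx1, hx⟩ := G.exists_eigenvector_adjSpectralRadius_le_one
    rw [hρ] at hle
    obtain ⟨P, hP, hadj⟩ := SimpleGraph.exists_card_eq_two_adj_iff hG hn hV hu hnn hx1 hx
      ((Real.sqrt_nonneg _).trans hle) ((Real.sqrt_le_left ((Real.sqrt_nonneg _).trans hle)).1 hle)
    exact hiso (SimpleGraph.nonempty_iso_completeBipartiteGraph_of_adj_iff hV hP hadj)
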